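/- For $\alpha,\beta>0$ let $E_{\alpha,\beta}(z)=\sum_{k=0}^\infty \frac{z^k}{\Gamma(k\alpha+\beta)}$ be the two-parameter Mittag-Leffler function. For $0<\nu<1$, $\mu\ge 0$, $t>0$ and $u>0$ let $$f_{\nu,\mu}(t;u)=\mathcal L^{-1}\left\{\frac{e^{-u s^\nu}}{s^\mu}\right\}(t)=\frac1{2\pi i}\int_{c-i\infty}^{c+i\infty}e^{st}\,\frac{e^{-us^\nu}}{s^\mu}\,ds,\qquad c>0,$$ with principal branches of the powers, so that $f_{\nu,\mu}(t;1)=f_{\nu,\mu}(t)$ is the inverse Laplace transform of $s^{-\mu}e^{-s^\nu}$. Let $\alpha>0$, $\beta>0$, $0<\nu<1$, $\mu\ge0$, $t>0$, $c>0$ and $\lambda\in\mathbb C$. Then, for either choice of the sign, the integral on the left-hand side below converges absolutely, and $$\int_0^\infty u^{\beta-1}E_{\alpha,\beta}(\pm\lambda u^\alpha)\,f_{\nu,\mu}(t;u)\,du=t^{\beta\nu+\mu-1}\,E_{\alpha\nu,\,\beta\nu+\mu}(\pm\lambda t^{\alpha\nu}).$$ In particular, for $\beta=1$, $\beta=\alpha$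 and $\beta=\alpha+1$, $$\int_0^\infty E_{\alpha,1}(\pm\lambda u^\alpha)\,f_{\nu,\mu}(t;u)\,du=t^{\nu+\mu-1}E_{\alpha\nu,\,\nu+\mu}(\pm\lambda t^{\alpha\nu}),$$ $$\int_0^\infty u^{\alpha-1}E_{\alpha,\alpha}(\pm\lambda u^\alpha)\,f_{\nu,\mu}(t;u)\,du=t^{\alpha\nu+\mu-1}E_{\alpha\nu,\,\alpha\nu+\mu}(\pm\lambda t^{\alpha\nu}),$$ $$\int_0^\infty u^{\alpha}E_{\alpha,\alpha+1}(\pm\lambda u^\alpha)\,f_{\nu,\mu}(t;u)\,du=t^{(\alpha+1)\nu+\mu-1}E_{\alpha\nu,\,(\alpha+1)\nu+\mu}(\pm\lambda t^{\alpha\nu}).$$ -/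

import Mathlib

open MeasureTheory Set

noncomputable section

/-- The two-parameter Mittag-Leffler function `E_{α,β}(z) = ∑_{k ≥ 0} z ^ k / Γ(k α + β)`. -/
def mittagLeffler (α β : ℝ) (z : ℂ) : ℂ :=
  ∑' k : ℕ, z ^ k / Complex.Gamma ((k * α + β : ℝ) : ℂ)

/-- The complex inversion formula for the Laplace transform,
`(1 / (2 π i)) ∫_{c - i ∞}^{c + i ∞} exp (s t) F(s) ds`, along the line `s = c + i y`. -/
def bromwich (c : ℝ) (F : ℂ → ℂ) (t : ℝ) : ℂ :=
  1 / (2 * Real.pi * Complex.I) *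
    ∫ y : ℝ, Complex.exp ((c + y * Complex.I) * t) * F (c + y * Complex.I) * Complex.I

/-- The Laplace transform `s ↦ exp (-u s ^ ν) / s ^ μ` (principal branches). -/
def laplaceF (ν μ u : ℝ) (s : ℂ) : ℂ :=
  Complex.exp (-(u * s ^ (ν : ℂ))) / s ^ (μ : ℂ)

/-- `f_{ν,μ}(t; u)`, the inverse Laplace transform at `t` of `s ↦ exp (-u s ^ ν) / s ^ μ`,
computed on the line `Re s = c`; for `u = 1` this is `f_{ν,μ}(t)`. -/
def fInv (c ν μ t u : ℝ) : ℂ :=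
  bromwich c (laplaceF ν μ u) t

/-- For `u > 0` the integral that defines `fInv` converges absolutely. -/
theorem integrable_fInv_integrand {c ν μ u : ℝ} (t : ℝ) (hc : 0 < c) (hν0 : 0 < ν) (hν1 : ν < 1)
    (hμ : 0 ≤ μ) (hu : 0 < u) :
    Integrable (fun y : ℝ => Complex.exp ((c + y * Complex.I) * t) *
      laplaceF ν μ u (c + y * Complex.I) * Complex.I) := by
  have hcos : 0 < Real.cos (ν * (Real.pi / 2)) := by
    apply Real.cos_pos_of_mem_Ioo
    constructor <;> nlinarith [Real.pi_pos]
  set b : ℝ := u * Real.cos (ν * (Real.pi / 2)) with hb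
  have hb0 : 0 < b := mul_pos hu hcos
  have hI0 : IntegrableOn (fun y : ℝ => Real.exp (-b * |y| ^ ν)) (Ioi 0) := by
    have h := integrableOn_rpow_mul_exp_neg_mul_rpow (p := ν) (s := 0) (b := b) (by norm_num)
      hν0 hb0
    refine h.congr_fun (fun y hy => ?_) measurableSet_Ioi
    simp [abs_of_pos (mem_Ioi.1 hy)]
  have hI : Integrable (fun y : ℝ => Real.exp (-b * |y| ^ ν)) := by
    have hIic : IntegrableOn (fun y : ℝ => Real.exp (-b * |y| ^ ν)) (Iic 0) := by
      rw [← Measure.map_neg_eq_self (volume : Measure ℝ)]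
      have m : MeasurableEmbedding fun x : ℝ => -x := (Homeomorph.neg ℝ).measurableEmbedding
      rw [m.integrableOn_map_iff]
      simp_rw [Function.comp_def, abs_neg, neg_preimage, neg_Iic, neg_zero]
      exact Iff.mpr integrableOn_Ici_iff_integrableOn_Ioi hI0
    rw [← integrableOn_univ, ← Iic_union_Ioi (a := (0 : ℝ))]
    exact hIic.union hI0
  have hre : ∀ y : ℝ, ((c : ℂ) + y * Complex.I).re = c := fun y => by simp
  have him : ∀ y : ℝ, ((c : ℂ) + y * Complex.I).im = y := fun y => by simp
  have hne : ∀ y : ℝ, (c : ℂ) + y * Complex.I ≠ 0 := fun y h => by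
    have := congrArg Complex.re h
    rw [hre] at this
    simp at this
    exact hc.ne' this
  have hsl : ∀ y : ℝ, (c : ℂ) + y * Complex.I ∈ Complex.slitPlane := fun y => by
    left
    rw [hre]
    exact hc
  have hpow : ∀ a : ℝ, Continuous fun y : ℝ => ((c : ℂ) + y * Complex.I) ^ (a : ℂ) := fun a =>
    Continuous.cpow (by fun_prop) continuous_const hsl
  have hcont : Continuous (fun y : ℝ => Complex.exp ((c + y * Complex.I) * t) *
      laplaceF ν μ u (c + y * Complex.I) * Complex.I) := by
    unfold laplaceF
    have h1 := hpow ν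
    have h2 := hpow μ
    refine Continuous.mul (Continuous.mul (by fun_prop) (Continuous.div (by fun_prop) h2 ?_))
      continuous_const
    intro y
    simp [Complex.cpow_eq_zero_iff, hne y]
  refine (hI.const_mul (Real.exp (c * t) * (c ^ μ)⁻¹)).mono' hcont.aestronglyMeasurable ?_
  refine Filter.Eventually.of_forall fun y => ?_
  set s : ℂ := c + y * Complex.I with hs
  have hsc : c ≤ ‖s‖ := by
    have := Complex.re_le_norm s
    rwa [hs, hre, ← hs] at this
  have hsy : |y| ≤ ‖s‖ := by
    have := Complex.abs_im_le_norm s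
    rwa [hs, him, ← hs] at this
  have harg : |s.arg| ≤ Real.pi / 2 := by
    rw [Complex.abs_arg_le_pi_div_two_iff, hs, hre]
    exact hc.le
  have hpre : (s ^ (ν : ℂ)).re = ‖s‖ ^ ν * Real.cos (ν * s.arg) := by
    rw [Complex.cpow_ofReal_re, mul_comm ν]
  have hcosle : Real.cos (ν * (Real.pi / 2)) ≤ Real.cos (ν * s.arg) := by
    rw [← Real.cos_abs (ν * s.arg), abs_mul, abs_of_pos hν0]
    apply Real.cos_le_cos_of_nonneg_of_le_pi
    · positivity
    · nlinarith [Real.pi_pos]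
    · gcongr
  have hexp : ‖Complex.exp (-(u * s ^ (ν : ℂ)))‖ ≤ Real.exp (-b * |y| ^ ν) := by
    rw [Complex.norm_exp, Real.exp_le_exp, Complex.neg_re, Complex.re_ofReal_mul, hpre, hb]
    have h1 : |y| ^ ν ≤ ‖s‖ ^ ν := Real.rpow_le_rpow (abs_nonneg y) hsy hν0.le
    have h2 : |y| ^ ν * Real.cos (ν * (Real.pi / 2)) ≤ ‖s‖ ^ ν * Real.cos (ν * s.arg) :=
      mul_le_mul h1 hcosle hcos.le (by positivity)
    nlinarith
  have hexp1 : ‖Complex.exp (s * t)‖ = Real.exp (c * t) := by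
    rw [Complex.norm_exp, Complex.re_mul_ofReal, hs, hre]
  have hden : ‖s ^ (μ : ℂ)‖⁻¹ ≤ (c ^ μ)⁻¹ := by
    rw [Complex.norm_cpow_real]
    exact inv_anti₀ (Real.rpow_pos_of_pos hc μ) (Real.rpow_le_rpow hc.le hsc hμ)
  rw [norm_mul, norm_mul, Complex.norm_I, mul_one, hexp1, laplaceF, norm_div, div_eq_mul_inv]
  calc Real.exp (c * t) * (‖Complex.exp (-(u * s ^ (ν : ℂ)))‖ * ‖s ^ (μ : ℂ)‖⁻¹)
      ≤ Real.exp (c * t) * (Real.exp (-b * |y| ^ ν) * (c ^ μ)⁻¹) := by gcongr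
    _ = Real.exp (c * t) * (c ^ μ)⁻¹ * Real.exp (-b * |y| ^ ν) := by ring

end

/-! Expand `E_{α,β}` in its power series and integrate term by term. Everything then rests on the
Mellin transform `∫ u^(γ-1) f(t;u) du = Γ(γ) t^(γν+μ-1) / Γ(γν+μ)` at `γ = kα + β`
(`integral_rpow_mul_fInv`): its `Γ(γ)` cancels the coefficient `1/Γ(kα+β)` and leaves the terms of
the series on the right-hand side.

Formally the Mellin transform follows by exchanging the `u`- and `s`-integrals and inverting
`s^(-(μ+νγ))`. That double integral is not absolutely convergent when `μ + νγ ≤ 1`, so one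
integrates by parts in `s` beforehand (`fInv_eq_integral_mul_laplaceLogDeriv`). This costs a factor
`1/t` and gains one power of `s`: the exponent becomes `-(μ+νγ+1)`, which is absolutely integrable,
and the inverse transform of the power is Fourier inversion (`integral_cexp_mul_vertical_cpow`).

To sum the series, the `L¹` norms of the terms are bounded by a linear factor in `k` times `q^k`,
with `q = ‖w‖ κ^(-α) c^(-να)` and `κ = cos(νπ/2)`. Since `f` does not depend on the abscissa `c`
(`fInv_eq_fInv`), the line can be moved to the right until `q < 1`. -/

/-- A series of integrable functions with summable `L¹` norms has an integrable sum. -/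
theorem integrable_tsum_of_summable_integral_norm {X E ι : Type*} [MeasurableSpace X]
    {m : Measure X} [NormedAddCommGroup E] [CompleteSpace E] [Countable ι] {F : ι → X → E}
    (hF : ∀ i, Integrable (F i) m) (hs : Summable fun i => ∫ x, ‖F i x‖ ∂m) :
    Integrable (fun x => ∑' i, F i x) m := by
  have hfin : ∑' i, ∫⁻ x, ‖F i x‖ₑ ∂m ≠ ⊤ := by
    have h : ∀ i, ∫⁻ x, ‖F i x‖ₑ ∂m = ENNReal.ofReal (∫ x, ‖F i x‖ ∂m) := fun i =>
      (ofReal_integral_norm_eq_lintegral_enorm (hF i)).symm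
    simp_rw [h]
    exact hs.tsum_ofReal_ne_top
  have hae : ∀ᵐ x ∂m, Summable fun i => ‖F i x‖ :=
    summable_norm_of_tsum_eLpNorm_ne_top le_rfl (fun i => (hF i).1)
      (by simpa only [eLpNorm_one_eq_lintegral_enorm] using hfin)
  have hm : AEStronglyMeasurable (fun x => ∑' i, F i x) m := by
    refine aestronglyMeasurable_of_tendsto_ae (Filter.atTop : Filter (Finset ι))
      (f := fun s x => ∑ i ∈ s, F i x)
      (fun s => (integrable_finsetSum s fun i _ => hF i).1) ?_
    filter_upwards [hae] with x hx using hx.of_norm.hasSum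
  refine ⟨hm, ?_⟩
  rw [← lintegral_tsum fun i => (hF i).1.enorm] at hfin
  refine lt_of_le_of_lt (lintegral_mono_ae ?_) hfin.lt_top
  filter_upwards [hae] with x hx
  calc ‖∑' i, F i x‖ₑ ≤ ENNReal.ofReal (∑' i, ‖F i x‖) := by
        rw [← ofReal_norm]
        exact ENNReal.ofReal_le_ofReal (norm_tsum_le_tsum_norm hx)
    _ = ∑' i, ‖F i x‖ₑ := by
        rw [ENNReal.ofReal_tsum_of_nonneg (fun _ => norm_nonneg _) hx]
        simp

/-! ### Gamma integrals with a parameter in the right half-plane -/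

theorem integrableOn_rpow_sub_one_mul_exp_neg_mul {a r : ℝ} (ha : 0 < a) (hr : 0 < r) :
    IntegrableOn (fun u : ℝ => u ^ (a - 1) * Real.exp (-(u * r))) (Ioi 0) := by
  have h := integrableOn_rpow_mul_exp_neg_mul_rpow (p := 1) (s := a - 1) (b := r) (by linarith)
    one_pos hr
  refine h.congr_fun (fun u _ => ?_) measurableSet_Ioi
  simp [mul_comm]

theorem integral_rpow_sub_one_mul_exp_neg_mul {a r : ℝ} (ha : 0 < a) (hr : 0 < r) :
    ∫ u in Ioi (0 : ℝ), u ^ (a - 1) * Real.exp (-(u * r)) = Real.Gamma a * r ^ (-a) := by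
  have h := Real.integral_rpow_mul_exp_neg_mul_Ioi ha hr
  simp_rw [mul_comm r] at h
  rw [h, one_div, Real.inv_rpow hr.le, Real.rpow_neg hr.le, mul_comm]

theorem norm_rpow_mul_cexp_neg_mul {a u : ℝ} (hu : 0 < u) (r : ℂ) :
    ‖((u ^ a : ℝ) : ℂ) * Complex.exp (-(u * r))‖ = u ^ a * Real.exp (-(u * r.re)) := by
  rw [norm_mul, Complex.norm_real, Complex.norm_exp, Real.norm_of_nonneg (by positivity)]
  simp

theorem measurable_rpow_mul_cexp_neg_mul (a : ℝ) (r : ℂ) :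
    Measurable fun u : ℝ => ((u ^ a : ℝ) : ℂ) * Complex.exp (-(u * r)) := by
  fun_prop

theorem integrableOn_rpow_sub_one_mul_cexp_neg_mul {a : ℝ} {r : ℂ} (ha : 0 < a) (hr : 0 < r.re) :
    IntegrableOn (fun u : ℝ => ((u ^ (a - 1) : ℝ) : ℂ) * Complex.exp (-(u * r))) (Ioi 0) := by
  refine (integrableOn_rpow_sub_one_mul_exp_neg_mul ha hr).mono'
    (measurable_rpow_mul_cexp_neg_mul _ _).aestronglyMeasurable ?_
  filter_upwards [ae_restrict_mem measurableSet_Ioi] with u hu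
  exact (norm_rpow_mul_cexp_neg_mul hu r).le

/-- Supplies the holomorphy needed to continue the real Gamma integral to complex `r`. -/
theorem hasDerivAt_integral_rpow_mul_cexp_neg_mul {a : ℝ} {r : ℂ} (ha : 0 < a) (hr : 0 < r.re) :
    HasDerivAt (fun z : ℂ => ∫ u in Ioi (0 : ℝ), ((u ^ (a - 1) : ℝ) : ℂ) * Complex.exp (-(u * z)))
      (∫ u in Ioi (0 : ℝ), -(((u ^ a : ℝ) : ℂ) * Complex.exp (-(u * r)))) r := by
  have hopen : IsOpen {z : ℂ | r.re / 2 < z.re} := isOpen_lt continuous_const Complex.continuous_re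
  refine (hasDerivAt_integral_of_dominated_loc_of_deriv_le
    (F := fun (z : ℂ) (u : ℝ) => ((u ^ (a - 1) : ℝ) : ℂ) * Complex.exp (-(u * z)))
    (F' := fun (z : ℂ) (u : ℝ) => -(((u ^ a : ℝ) : ℂ) * Complex.exp (-(u * z))))
    -- On `Re z > Re r / 2` the exponential is dominated uniformly. The exponent `a + 1 - 1` matches
    -- the form of the Gamma integral at `a + 1`.
    (bound := fun u : ℝ => u ^ (a + 1 - 1) * Real.exp (-(u * (r.re / 2))))
    (hopen.mem_nhds (by change r.re / 2 < r.re; linarith)) ?_ ?_ ?_ ?_ ?_ ?_).2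
  · exact Filter.Eventually.of_forall fun z =>
      (measurable_rpow_mul_cexp_neg_mul _ _).aestronglyMeasurable
  · exact integrableOn_rpow_sub_one_mul_cexp_neg_mul ha hr
  · exact (measurable_rpow_mul_cexp_neg_mul _ _).neg.aestronglyMeasurable
  · filter_upwards [ae_restrict_mem measurableSet_Ioi] with u (hu : 0 < u) z hz
    rw [norm_neg, norm_rpow_mul_cexp_neg_mul hu, add_sub_cancel_right]
    have : r.re / 2 < z.re := hz
    gcongr
  · exact integrableOn_rpow_sub_one_mul_exp_neg_mul (by linarith) (by linarith)
  · filter_upwards [ae_restrict_mem measurableSet_Ioi] with u (hu : 0 < u) z _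
    have h : HasDerivAt (fun z : ℂ => -((u : ℂ) * z)) (-((u : ℂ) * 1)) z :=
      ((hasDerivAt_id z).const_mul (u : ℂ)).neg
    refine (h.cexp.const_mul ((u ^ (a - 1) : ℝ) : ℂ)).congr_deriv ?_
    have : u ^ a = u ^ (a - 1) * u := by
      rw [← Real.rpow_add_one hu.ne', sub_add_cancel]
    rw [this]
    push_cast
    ring

/-- The Laplace transform of a power, at a complex point of the right half-plane. -/
theorem integral_rpow_sub_one_mul_cexp_neg_mul {a : ℝ} {r : ℂ} (ha : 0 < a) (hr : 0 < r.re) :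
    ∫ u in Ioi (0 : ℝ), ((u ^ (a - 1) : ℝ) : ℂ) * Complex.exp (-(u * r)) =
      Real.Gamma a * r ^ (-a : ℂ) := by
  have hopen : IsOpen {z : ℂ | 0 < z.re} := isOpen_lt continuous_const Complex.continuous_re
  have hf : AnalyticOnNhd ℂ (fun z : ℂ => ∫ u in Ioi (0 : ℝ),
      ((u ^ (a - 1) : ℝ) : ℂ) * Complex.exp (-(u * z))) {z : ℂ | 0 < z.re} :=
    DifferentiableOn.analyticOnNhd (fun z hz =>
      (hasDerivAt_integral_rpow_mul_cexp_neg_mul ha hz).differentiableAt.differentiableWithinAt)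
      hopen
  have hg : AnalyticOnNhd ℂ (fun z : ℂ => (Real.Gamma a : ℂ) * z ^ (-a : ℂ)) {z : ℂ | 0 < z.re} :=
    DifferentiableOn.analyticOnNhd (fun z hz => by
      refine DifferentiableAt.differentiableWithinAt ?_
      exact (differentiableAt_id.cpow_const (Or.inl hz)).const_mul _) hopen
  have hconn : IsPreconnected {z : ℂ | 0 < z.re} := (convex_halfSpace_re_gt 0).isPreconnected
  -- Identity theorem: both sides are holomorphic on the half-plane and agree at positive reals,
  -- which accumulate at `1`.
  refine hf.eqOn_of_preconnected_of_frequently_eq hg hconn (z₀ := 1) (by simp) ?_ hr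
  have hT : Filter.Tendsto (fun x : ℝ => (x : ℂ)) (nhdsWithin 1 {1}ᶜ) (nhdsWithin 1 {1}ᶜ) := by
    refine tendsto_nhdsWithin_iff.2 ⟨?_, ?_⟩
    · exact (Complex.continuous_ofReal.tendsto' 1 1 (by simp)).mono_left nhdsWithin_le_nhds
    · filter_upwards [self_mem_nhdsWithin] with x hx
      simpa using hx
  refine hT.frequently (Filter.Eventually.frequently ?_)
  filter_upwards [nhdsWithin_le_nhds (lt_mem_nhds (zero_lt_one' ℝ))] with x hx
  have h := integral_rpow_sub_one_mul_exp_neg_mul ha hx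
  have h2 : ((x : ℂ) ^ (-a : ℂ)) = ((x ^ (-a) : ℝ) : ℂ) := by
    rw [Complex.ofReal_cpow hx.le]
    simp
  rw [h2, ← Complex.ofReal_mul, ← h, ← integral_complex_ofReal]
  simp

/-! ### Powers on a vertical line and their inverse Laplace transform -/

theorem vertical_mem_slitPlane {c : ℝ} (hc : 0 < c) (y : ℝ) :
    (c : ℂ) + y * Complex.I ∈ Complex.slitPlane := by
  left
  simpa using hc

theorem vertical_ne_zero {c : ℝ} (hc : 0 < c) (y : ℝ) : (c : ℂ) + y * Complex.I ≠ 0 :=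
  Complex.slitPlane_ne_zero (vertical_mem_slitPlane hc y)

theorem le_norm_vertical (c y : ℝ) : c ≤ ‖(c : ℂ) + y * Complex.I‖ := by
  simpa using Complex.re_le_norm ((c : ℂ) + y * Complex.I)

theorem abs_le_norm_vertical (c y : ℝ) : |y| ≤ ‖(c : ℂ) + y * Complex.I‖ := by
  simpa using Complex.abs_im_le_norm ((c : ℂ) + y * Complex.I)

theorem norm_vertical_pos {c : ℝ} (hc : 0 < c) (y : ℝ) : 0 < ‖(c : ℂ) + y * Complex.I‖ :=
  norm_pos_iff.2 (vertical_ne_zero hc y)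

theorem continuous_vertical_cpow {c : ℝ} (hc : 0 < c) (a : ℂ) :
    Continuous fun y : ℝ => ((c : ℂ) + y * Complex.I) ^ a :=
  Continuous.cpow (by fun_prop) continuous_const (vertical_mem_slitPlane hc)

theorem continuous_norm_vertical_rpow {c : ℝ} (hc : 0 < c) (a : ℝ) :
    Continuous fun y : ℝ => ‖(c : ℂ) + y * Complex.I‖ ^ a :=
  Continuous.rpow_const (by fun_prop) fun y => Or.inl (norm_vertical_pos hc y).ne'

theorem integrable_norm_vertical_rpow {c a : ℝ} (hc : 0 < c) (ha : 1 < a) :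
    Integrable fun y : ℝ => ‖(c : ℂ) + y * Complex.I‖ ^ (-a) := by
  have h1 : Integrable fun y : ℝ => (1 + ‖y‖) ^ (-a) :=
    integrable_one_add_norm (by simpa using ha)
  -- Averaging `c ≤ ‖s‖` and `|y| ≤ ‖s‖` gives `m * (1 + |y|) ≤ ‖s‖`.
  set m : ℝ := min c 1 / 2 with hm
  have hm0 : 0 < m := by positivity
  refine (h1.const_mul (m ^ (-a))).mono'
    (continuous_norm_vertical_rpow hc _).aestronglyMeasurable (Filter.Eventually.of_forall fun y => ?_)
  rw [Real.norm_of_nonneg (by positivity), ← Real.mul_rpow hm0.le (by positivity)]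
  refine Real.rpow_le_rpow_of_nonpos (by positivity) ?_ (by linarith)
  have h2 := le_norm_vertical c y
  have h3 := abs_le_norm_vertical c y
  have h4 : min c 1 ≤ c := min_le_left _ _
  have h5 : min c 1 ≤ 1 := min_le_right _ _
  have h6 : min c 1 * |y| ≤ 1 * |y| := by gcongr
  rw [hm, Real.norm_eq_abs]
  linarith

theorem norm_vertical_cpow {c : ℝ} (y a : ℝ) :
    ‖((c : ℂ) + y * Complex.I) ^ (a : ℂ)‖ = ‖(c : ℂ) + y * Complex.I‖ ^ a :=
  Complex.norm_cpow_real _ _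

theorem integrable_vertical_cpow {c a : ℝ} (hc : 0 < c) (ha : 1 < a) :
    Integrable fun y : ℝ => ((c : ℂ) + y * Complex.I) ^ (-a : ℂ) := by
  refine (integrable_norm_vertical_rpow hc ha).mono'
    (continuous_vertical_cpow hc _).aestronglyMeasurable (Filter.Eventually.of_forall fun y => ?_)
  rw [← Complex.ofReal_neg, norm_vertical_cpow]

open FourierTransform in
/-- The Fourier transform of `x ^ δ * exp (-c x)` on the half-line. -/
theorem fourier_posPart_rpow_mul_exp {c δ : ℝ} (hc : 0 < c) (hδ : 0 < δ) (w : ℝ) :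
    𝓕 (fun x : ℝ => (((max x 0) ^ δ : ℝ) : ℂ) * Complex.exp (-(x * c))) w =
      Real.Gamma (δ + 1) * ((c : ℂ) + (2 * Real.pi * w : ℝ) * Complex.I) ^ (-(δ + 1 : ℝ) : ℂ) := by
  rw [Real.fourier_real_eq_integral_exp_smul, ← integral_rpow_sub_one_mul_cexp_neg_mul
    (by linarith) (by simpa using hc), ← integral_indicator measurableSet_Ioi]
  congr 1 with x
  by_cases hx : 0 < x
  · rw [indicator_of_mem (mem_Ioi.2 hx), max_eq_left hx.le, smul_eq_mul, mul_left_comm,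
      ← Complex.exp_add, add_sub_cancel_right]
    congr 2
    push_cast
    ring
  · rw [indicator_of_notMem (by simpa using hx), max_eq_right (not_lt.1 hx), Real.zero_rpow hδ.ne']
    simp

open FourierTransform in
/-- The inverse Laplace transform of a power of exponent less than `-1`. -/
theorem integral_cexp_mul_vertical_cpow {c δ t : ℝ} (hc : 0 < c) (hδ : 0 < δ) (ht : 0 < t) :
    ∫ y : ℝ, Complex.exp ((c + y * Complex.I) * t) *
      ((c : ℂ) + y * Complex.I) ^ (-(δ + 1 : ℝ) : ℂ) =
      2 * Real.pi * ((t ^ δ : ℝ) : ℂ) / Real.Gamma (δ + 1) := by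
  have hΓ : (Real.Gamma (δ + 1) : ℂ) ≠ 0 :=
    Complex.ofReal_ne_zero.2 (Real.Gamma_pos_of_pos (by linarith)).ne'
  -- Since `0 ^ δ = 0` for `δ > 0`, the cutoff `max x 0` makes `f` continuous on all of `ℝ`, as
  -- pointwise Fourier inversion requires.
  set f : ℝ → ℂ := fun x => (((max x 0) ^ δ : ℝ) : ℂ) * Complex.exp (-(x * c)) with hf
  have hcont : Continuous f := by
    have : Continuous fun x : ℝ => (max x 0) ^ δ :=
      Continuous.rpow_const (by fun_prop) fun _ => Or.inr hδ.le
    fun_prop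
  have hint : Integrable f := by
    have h := integrableOn_rpow_sub_one_mul_cexp_neg_mul (a := δ + 1) (r := c) (by linarith)
      (by simpa using hc)
    rw [← integrable_indicator_iff measurableSet_Ioi] at h
    refine h.congr (Filter.Eventually.of_forall fun x => ?_)
    by_cases hx : 0 < x
    · simp [hf, hx, hx.le]
    · simp [hf, hx, not_lt.1 hx, Real.zero_rpow hδ.ne']
  have hF : 𝓕 f = fun w : ℝ => (Real.Gamma (δ + 1) : ℂ) *
      ((c : ℂ) + (2 * Real.pi * w : ℝ) * Complex.I) ^ (-(δ + 1 : ℝ) : ℂ) :=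
    funext fun w => fourier_posPart_rpow_mul_exp hc hδ w
  have hFint : Integrable (𝓕 f) := by
    rw [hF]
    exact ((integrable_vertical_cpow hc (a := δ + 1) (by linarith)).comp_mul_left'
      (R := 2 * Real.pi) (by positivity)).const_mul _
  have hinv := congrFun (hcont.fourierInv_fourier_eq hint hFint) t
  rw [Real.fourierInv_eq', hF] at hinv
  have hsub := Measure.integral_comp_mul_left (fun y : ℝ => Complex.exp ((c + y * Complex.I) * t) *
      ((c : ℂ) + y * Complex.I) ^ (-(δ + 1 : ℝ) : ℂ)) (2 * Real.pi)
  have hkey : ∫ v : ℝ, (Complex.exp ((c + (2 * Real.pi * v : ℝ) * Complex.I) * t) *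
      ((c : ℂ) + (2 * Real.pi * v : ℝ) * Complex.I) ^ (-(δ + 1 : ℝ) : ℂ)) =
      ((t ^ δ : ℝ) : ℂ) / Real.Gamma (δ + 1) := by
    have h1 : f t * (Complex.exp (c * t) / Real.Gamma (δ + 1)) =
        ((t ^ δ : ℝ) : ℂ) / Real.Gamma (δ + 1) := by
      rw [hf]
      simp only [max_eq_left ht.le]
      rw [mul_comm (t : ℂ), Complex.exp_neg]
      field_simp
    rw [← h1, ← hinv, ← integral_mul_const]
    congr 1 with v
    have h2 : Complex.exp ((c + (2 * Real.pi * v : ℝ) * Complex.I) * t) =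
        Complex.exp ((2 * Real.pi * inner ℝ v t : ℝ) * Complex.I) * Complex.exp (c * t) := by
      rw [← Complex.exp_add]
      congr 1
      simp only [RCLike.inner_apply, conj_trivial]
      push_cast
      ring
    rw [smul_eq_mul, h2]
    field_simp
  rw [hkey, abs_of_pos (by positivity), Complex.real_smul] at hsub
  have h2π : ((2 * Real.pi : ℝ) : ℂ) ≠ 0 := Complex.ofReal_ne_zero.2 (by positivity)
  rw [mul_div_assoc, hsub, Complex.ofReal_inv, ← mul_assoc]
  rw [show (2 * (Real.pi : ℂ)) = ((2 * Real.pi : ℝ) : ℂ) by push_cast; rfl, mul_inv_cancel₀ h2π,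
    one_mul]

/-! ### Decay of the transform in the right half-plane -/

theorem cos_mul_pi_div_two_pos {ν : ℝ} (hν0 : 0 < ν) (hν1 : ν < 1) :
    0 < Real.cos (ν * (Real.pi / 2)) := by
  apply Real.cos_pos_of_mem_Ioo
  constructor <;> nlinarith [Real.pi_pos]

/-- `Re s^ν = ‖s‖^ν cos(ν arg s)` with `|arg s| ≤ π/2`, and cosine decreases on `[0, π]`. -/
theorem cos_mul_norm_rpow_le_re_cpow {ν : ℝ} (hν0 : 0 < ν) (hν1 : ν < 1) {s : ℂ} (hs : 0 < s.re) :
    Real.cos (ν * (Real.pi / 2)) * ‖s‖ ^ ν ≤ (s ^ (ν : ℂ)).re := by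
  have harg : |s.arg| ≤ Real.pi / 2 := Complex.abs_arg_le_pi_div_two_iff.2 hs.le
  rw [Complex.cpow_ofReal_re, mul_comm, mul_comm s.arg]
  gcongr
  rw [← Real.cos_abs (ν * s.arg), abs_mul, abs_of_pos hν0]
  apply Real.cos_le_cos_of_nonneg_of_le_pi
  · positivity
  · nlinarith [Real.pi_pos]
  · gcongr

theorem re_cpow_pos {ν : ℝ} (hν0 : 0 < ν) (hν1 : ν < 1) {s : ℂ} (hs : 0 < s.re) :
    0 < (s ^ (ν : ℂ)).re := by
  have h : 0 < ‖s‖ := norm_pos_iff.2 (Complex.slitPlane_ne_zero (Or.inl hs))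
  exact (mul_pos (cos_mul_pi_div_two_pos hν0 hν1) (by positivity)).trans_le
    (cos_mul_norm_rpow_le_re_cpow hν0 hν1 hs)

theorem norm_laplaceF_le {ν μ u : ℝ} (hν0 : 0 < ν) (hν1 : ν < 1) (hu : 0 < u) {s : ℂ}
    (hs : 0 < s.re) :
    ‖laplaceF ν μ u s‖ ≤
      Real.exp (-(u * (Real.cos (ν * (Real.pi / 2)) * ‖s‖ ^ ν))) * ‖s‖ ^ (-μ) := by
  rw [laplaceF, norm_div, Complex.norm_cpow_real, Complex.norm_exp, Complex.neg_re,
    Complex.re_ofReal_mul, Real.rpow_neg (norm_nonneg s), div_eq_mul_inv]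
  have := cos_mul_norm_rpow_le_re_cpow hν0 hν1 hs
  gcongr

theorem norm_cexp_vertical_mul (c t y : ℝ) :
    ‖Complex.exp ((c + y * Complex.I) * t)‖ = Real.exp (c * t) := by
  simp [Complex.norm_exp]

/-- Minus the logarithmic derivative of `laplaceF ν μ u`. -/
noncomputable def laplaceLogDeriv (ν μ u : ℝ) (s : ℂ) : ℂ :=
  u * ν * s ^ ((ν - 1 : ℝ) : ℂ) + μ * s⁻¹

theorem hasDerivAt_laplaceF (ν μ u : ℝ) {s : ℂ} (hs : s ∈ Complex.slitPlane) :
    HasDerivAt (laplaceF ν μ u) (-(laplaceF ν μ u s * laplaceLogDeriv ν μ u s)) s := by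
  have hs0 : s ≠ 0 := Complex.slitPlane_ne_zero hs
  have hsμ : s ^ (μ : ℂ) ≠ 0 := by simp [Complex.cpow_eq_zero_iff, hs0]
  have h1 : HasDerivAt (fun z : ℂ => -((u : ℂ) * z ^ (ν : ℂ)))
      (-((u : ℂ) * (ν * s ^ ((ν : ℂ) - 1) * 1))) s :=
    (((hasDerivAt_id s).cpow_const hs).const_mul (u : ℂ)).neg
  have h2 : HasDerivAt (fun z : ℂ => z ^ (μ : ℂ)) (μ * s ^ ((μ : ℂ) - 1) * 1) s :=
    (hasDerivAt_id s).cpow_const hs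
  refine (h1.cexp.div h2 hsμ).congr_deriv ?_
  simp only [laplaceF, laplaceLogDeriv, Complex.ofReal_sub, Complex.ofReal_one,
    Complex.cpow_sub _ _ hs0, Complex.cpow_one]
  field_simp
  ring

theorem continuous_laplaceF_vertical {c : ℝ} (hc : 0 < c) (ν μ u : ℝ) :
    Continuous fun y : ℝ => laplaceF ν μ u (c + y * Complex.I) := by
  refine continuous_iff_continuousAt.2 fun y => ContinuousAt.comp
    (f := fun y : ℝ => (c : ℂ) + y * Complex.I)
    (hasDerivAt_laplaceF ν μ u (vertical_mem_slitPlane hc y)).continuousAt (by fun_prop)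

theorem continuous_laplaceLogDeriv_vertical {c : ℝ} (hc : 0 < c) (ν μ u : ℝ) :
    Continuous fun y : ℝ => laplaceLogDeriv ν μ u (c + y * Complex.I) := by
  unfold laplaceLogDeriv
  have h1 := continuous_vertical_cpow hc ((ν - 1 : ℝ) : ℂ)
  have h2 : Continuous fun y : ℝ => ((c : ℂ) + y * Complex.I)⁻¹ :=
    Continuous.inv₀ (by fun_prop) (vertical_ne_zero hc)
  fun_prop

theorem norm_laplaceLogDeriv_le {ν μ u : ℝ} (hν0 : 0 < ν) (hμ : 0 ≤ μ) (hu : 0 < u) (s : ℂ) :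
    ‖laplaceLogDeriv ν μ u s‖ ≤ u * ν * ‖s‖ ^ (ν - 1) + μ * ‖s‖⁻¹ := by
  refine (norm_add_le _ _).trans_eq ?_
  simp only [norm_mul, Complex.norm_real, Complex.norm_cpow_real, norm_inv,
    Real.norm_of_nonneg hν0.le, Real.norm_of_nonneg hμ, Real.norm_of_nonneg hu.le]

theorem norm_laplaceLogDeriv_le_of_le {ν μ u a : ℝ} (hν0 : 0 < ν) (hν1 : ν < 1) (hμ : 0 ≤ μ)
    (hu : 0 < u) (ha : 0 < a) {s : ℂ} (hs : a ≤ ‖s‖) :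
    ‖laplaceLogDeriv ν μ u s‖ ≤ u * ν * a ^ (ν - 1) + μ * a⁻¹ := by
  refine (norm_laplaceLogDeriv_le hν0 hμ hu s).trans ?_
  have := Real.rpow_le_rpow_of_nonpos ha hs (by linarith : ν - 1 ≤ 0)
  gcongr

/-! ### Integration by parts along the vertical line -/

/-- The integrand of the inversion formula for `laplaceF ν μ u`. -/
noncomputable def bromwichKernel (ν μ t u : ℝ) (s : ℂ) : ℂ :=
  Complex.exp (s * t) * laplaceF ν μ u s

theorem hasDerivAt_bromwichKernel (ν μ t u : ℝ) {s : ℂ} (hs : s ∈ Complex.slitPlane) :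
    HasDerivAt (bromwichKernel ν μ t u)
      (bromwichKernel ν μ t u s * (t - laplaceLogDeriv ν μ u s)) s := by
  have h1 : HasDerivAt (fun z : ℂ => z * (t : ℂ)) (1 * (t : ℂ)) s := (hasDerivAt_id s).mul_const _
  refine (h1.cexp.mul (hasDerivAt_laplaceF ν μ u hs)).congr_deriv ?_
  rw [bromwichKernel]
  ring

theorem continuous_bromwichKernel_vertical {c : ℝ} (hc : 0 < c) (ν μ t u : ℝ) :
    Continuous fun y : ℝ => bromwichKernel ν μ t u (c + y * Complex.I) := by
  unfold bromwichKernel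
  have := continuous_laplaceF_vertical hc ν μ u
  fun_prop

theorem integrable_bromwichKernel_vertical {c ν μ u : ℝ} (t : ℝ) (hc : 0 < c) (hν0 : 0 < ν)
    (hν1 : ν < 1) (hμ : 0 ≤ μ) (hu : 0 < u) :
    Integrable fun y : ℝ => bromwichKernel ν μ t u (c + y * Complex.I) := by
  have h := (integrable_fInv_integrand t hc hν0 hν1 hμ hu).mul_const (-Complex.I)
  refine h.congr (Filter.Eventually.of_forall fun y => ?_)
  simp only [bromwichKernel]
  rw [mul_assoc, mul_neg, Complex.I_mul_I, neg_neg, mul_one]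

theorem integrable_bromwichKernel_mul_laplaceLogDeriv {c ν μ u : ℝ} (t : ℝ) (hc : 0 < c)
    (hν0 : 0 < ν) (hν1 : ν < 1) (hμ : 0 ≤ μ) (hu : 0 < u) :
    Integrable fun y : ℝ => bromwichKernel ν μ t u (c + y * Complex.I) *
      laplaceLogDeriv ν μ u (c + y * Complex.I) :=
  (integrable_bromwichKernel_vertical t hc hν0 hν1 hμ hu).mul_bdd
    (c := u * ν * c ^ (ν - 1) + μ * c⁻¹)
    (continuous_laplaceLogDeriv_vertical hc ν μ u).aestronglyMeasurable
    (Filter.Eventually.of_forall fun y =>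
      norm_laplaceLogDeriv_le_of_le hν0 hν1 hμ hu hc (le_norm_vertical c y))

theorem integrable_bromwichKernel_deriv {c ν μ u : ℝ} (t : ℝ) (hc : 0 < c)
    (hν0 : 0 < ν) (hν1 : ν < 1) (hμ : 0 ≤ μ) (hu : 0 < u) :
    Integrable fun y : ℝ => bromwichKernel ν μ t u (c + y * Complex.I) *
      (t - laplaceLogDeriv ν μ u (c + y * Complex.I)) := by
  simp_rw [mul_sub]
  exact ((integrable_bromwichKernel_vertical t hc hν0 hν1 hμ hu).mul_const _).sub
    (integrable_bromwichKernel_mul_laplaceLogDeriv t hc hν0 hν1 hμ hu)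

/-- Up to the factor `I`, the integrand is the `y`-derivative of the kernel along the line; both are
integrable, so no boundary terms survive. -/
theorem integral_bromwichKernel_deriv {c ν μ u : ℝ} (t : ℝ) (hc : 0 < c)
    (hν0 : 0 < ν) (hν1 : ν < 1) (hμ : 0 ≤ μ) (hu : 0 < u) :
    ∫ y : ℝ, bromwichKernel ν μ t u (c + y * Complex.I) *
      (t - laplaceLogDeriv ν μ u (c + y * Complex.I)) = 0 := by
  have h := integral_eq_zero_of_hasDerivAt_of_integrable
    (f := fun y : ℝ => bromwichKernel ν μ t u (c + y * Complex.I))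
    (f' := fun y : ℝ => bromwichKernel ν μ t u (c + y * Complex.I) *
      (t - laplaceLogDeriv ν μ u (c + y * Complex.I)) * Complex.I)
    (fun y => by
      have hl : HasDerivAt (fun y : ℝ => (c : ℂ) + y * Complex.I) Complex.I y := by
        simpa using (Complex.ofRealCLM.hasDerivAt.mul_const Complex.I).const_add (c : ℂ)
      exact (hasDerivAt_bromwichKernel ν μ t u (vertical_mem_slitPlane hc y)).comp y hl)
    ((integrable_bromwichKernel_deriv t hc hν0 hν1 hμ hu).mul_const _)
    (integrable_bromwichKernel_vertical t hc hν0 hν1 hμ hu)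
  rw [integral_mul_const] at h
  simpa using h

theorem mul_integral_bromwichKernel {c ν μ u : ℝ} (t : ℝ) (hc : 0 < c)
    (hν0 : 0 < ν) (hν1 : ν < 1) (hμ : 0 ≤ μ) (hu : 0 < u) :
    t * ∫ y : ℝ, bromwichKernel ν μ t u (c + y * Complex.I) =
      ∫ y : ℝ, bromwichKernel ν μ t u (c + y * Complex.I) *
        laplaceLogDeriv ν μ u (c + y * Complex.I) := by
  have h := integral_bromwichKernel_deriv t hc hν0 hν1 hμ hu
  simp_rw [mul_sub] at h
  rw [integral_sub ((integrable_bromwichKernel_vertical t hc hν0 hν1 hμ hu).mul_const _)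
    (integrable_bromwichKernel_mul_laplaceLogDeriv t hc hν0 hν1 hμ hu), integral_mul_const,
    sub_eq_zero] at h
  rw [mul_comm, h]

theorem fInv_eq_integral_bromwichKernel (c ν μ t u : ℝ) :
    fInv c ν μ t u =
      1 / (2 * Real.pi) * ∫ y : ℝ, bromwichKernel ν μ t u (c + y * Complex.I) := by
  rw [fInv, bromwich, integral_mul_const]
  simp only [bromwichKernel]
  generalize (∫ y : ℝ, Complex.exp ((c + y * Complex.I) * t) *
    laplaceF ν μ u (c + y * Complex.I)) = J
  have := Complex.I_ne_zero
  field_simp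

/-- The new factor is `u ν s^(ν-1) + μ/s`. In the Mellin integral a power `u` is worth `s^(-ν)`, so
both summands improve the decay by one power of `s`. -/
theorem fInv_eq_integral_mul_laplaceLogDeriv {c ν μ t u : ℝ} (hc : 0 < c)
    (hν0 : 0 < ν) (hν1 : ν < 1) (hμ : 0 ≤ μ) (ht : 0 < t) (hu : 0 < u) :
    fInv c ν μ t u = 1 / (2 * Real.pi * t) *
      ∫ y : ℝ, bromwichKernel ν μ t u (c + y * Complex.I) *
        laplaceLogDeriv ν μ u (c + y * Complex.I) := by
  have ht' : (t : ℂ) ≠ 0 := Complex.ofReal_ne_zero.2 ht.ne'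
  rw [fInv_eq_integral_bromwichKernel, ← mul_integral_bromwichKernel t hc hν0 hν1 hμ hu]
  generalize (∫ y : ℝ, bromwichKernel ν μ t u (c + y * Complex.I)) = J
  field_simp

/-! ### Independence of the abscissa -/

theorem integrable_exp_neg_mul_abs_rpow {b ν : ℝ} (hb : 0 < b) (hν0 : 0 < ν) :
    Integrable fun y : ℝ => Real.exp (-(b * |y| ^ ν)) := by
  have hI0 : IntegrableOn (fun y : ℝ => Real.exp (-(b * |y| ^ ν))) (Ioi 0) := by
    refine (integrableOn_rpow_mul_exp_neg_mul_rpow (p := ν) (s := 0) (b := b) (by norm_num)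
      hν0 hb).congr_fun (fun y hy => ?_) measurableSet_Ioi
    simp [abs_of_pos (mem_Ioi.1 hy)]
  rw [← integrableOn_univ, ← Iic_union_Ioi (a := (0 : ℝ))]
  refine IntegrableOn.union ?_ hI0
  have m : MeasurableEmbedding fun x : ℝ => -x := (Homeomorph.neg ℝ).measurableEmbedding
  rw [← Measure.map_neg_eq_self (volume : Measure ℝ), m.integrableOn_map_iff]
  simp_rw [Function.comp_def, abs_neg, neg_preimage, neg_Iic, neg_zero]
  exact Iff.mpr integrableOn_Ici_iff_integrableOn_Ioi hI0

theorem norm_bromwichKernel_le {a c A ν μ t u : ℝ} (hν0 : 0 < ν) (hν1 : ν < 1) (hμ : 0 ≤ μ)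
    (ht : 0 < t) (hu : 0 < u) (ha : 0 < a) (hac : a ≤ c) (hcA : c ≤ A) (y : ℝ) :
    ‖bromwichKernel ν μ t u (c + y * Complex.I)‖ ≤ Real.exp (A * t) *
      (Real.exp (-(u * Real.cos (ν * (Real.pi / 2)) * |y| ^ ν)) * a ^ (-μ)) := by
  have hκ := cos_mul_pi_div_two_pos hν0 hν1
  rw [bromwichKernel, norm_mul, norm_cexp_vertical_mul]
  have h1 := norm_laplaceF_le (μ := μ) hν0 hν1 hu (s := c + y * Complex.I)
    (by simpa using ha.trans_le hac)
  have h2 : ‖(c : ℂ) + y * Complex.I‖ ^ (-μ) ≤ a ^ (-μ) :=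
    Real.rpow_le_rpow_of_nonpos ha (hac.trans (le_norm_vertical c y)) (by linarith)
  have h3 : |y| ^ ν ≤ ‖(c : ℂ) + y * Complex.I‖ ^ ν := by
    have := abs_le_norm_vertical c y
    gcongr
  have h4 : Real.exp (-(u * (Real.cos (ν * (Real.pi / 2)) * ‖(c : ℂ) + y * Complex.I‖ ^ ν))) ≤
      Real.exp (-(u * Real.cos (ν * (Real.pi / 2)) * |y| ^ ν)) := by
    rw [mul_assoc]
    gcongr
  gcongr
  exact h1.trans (by gcongr)

/-- Differentiating in the abscissa puts the complex derivative of the kernel under the integral,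
and this integrates to zero along the line. It plays the role of Cauchy's theorem. -/
theorem hasDerivAt_integral_bromwichKernel {c ν μ t u : ℝ} (hc : 0 < c)
    (hν0 : 0 < ν) (hν1 : ν < 1) (hμ : 0 ≤ μ) (ht : 0 < t) (hu : 0 < u) :
    HasDerivAt (fun x : ℝ => ∫ y : ℝ, bromwichKernel ν μ t u (x + y * Complex.I)) 0 c := by
  have hκ := cos_mul_pi_div_two_pos hν0 hν1
  have hc2 : 0 < c / 2 := by linarith
  have h := (hasDerivAt_integral_of_dominated_loc_of_deriv_le
    (F := fun (x y : ℝ) => bromwichKernel ν μ t u (x + y * Complex.I))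
    (F' := fun (x y : ℝ) => bromwichKernel ν μ t u (x + y * Complex.I) *
      (t - laplaceLogDeriv ν μ u (x + y * Complex.I)))
    (bound := fun y : ℝ => Real.exp (2 * c * t) *
      (Real.exp (-(u * Real.cos (ν * (Real.pi / 2)) * |y| ^ ν)) * (c / 2) ^ (-μ)) *
      (t + (u * ν * (c / 2) ^ (ν - 1) + μ * (c / 2)⁻¹)))
    -- On `[c/2, 2c]` the lower end controls the negative powers of `‖s‖` and the upper end controls
    -- `exp(x t)`.
    (Icc_mem_nhds (by linarith : c / 2 < c) (by linarith : c < 2 * c)) ?_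
    (integrable_bromwichKernel_vertical t hc hν0 hν1 hμ hu)
    (integrable_bromwichKernel_deriv t hc hν0 hν1 hμ hu).1
    (μ := volume) ?_ ?_ ?_).2
  · rwa [integral_bromwichKernel_deriv t hc hν0 hν1 hμ hu] at h
  · filter_upwards [lt_mem_nhds hc] with x hx
    exact (continuous_bromwichKernel_vertical hx ν μ t u).aestronglyMeasurable
  · refine Filter.Eventually.of_forall fun y x hx => ?_
    rw [norm_mul]
    have h1 := norm_bromwichKernel_le (a := c / 2) (A := 2 * c) hν0 hν1 hμ ht hu hc2 hx.1 hx.2 y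
    have h2 : ‖(t : ℂ) - laplaceLogDeriv ν μ u (x + y * Complex.I)‖ ≤
        t + (u * ν * (c / 2) ^ (ν - 1) + μ * (c / 2)⁻¹) := by
      refine (norm_sub_le _ _).trans ?_
      rw [Complex.norm_real, Real.norm_of_nonneg ht.le]
      gcongr
      exact norm_laplaceLogDeriv_le_of_le hν0 hν1 hμ hu hc2
        (hx.1.trans (le_norm_vertical x y))
    gcongr
  · exact (((integrable_exp_neg_mul_abs_rpow (mul_pos hu hκ) hν0).mul_const _).const_mul
      _).mul_const _
  · refine Filter.Eventually.of_forall fun y x hx => ?_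
    have hx0 : 0 < x := hc2.trans_le hx.1
    have hl : HasDerivAt (fun x : ℝ => (x : ℂ) + y * Complex.I) 1 x :=
      Complex.ofRealCLM.hasDerivAt.add_const _
    have h := (hasDerivAt_bromwichKernel ν μ t u (vertical_mem_slitPlane hx0 y)).comp x hl
    rw [mul_one] at h
    exact h

/-- The inverse Laplace transform does not depend on the abscissa of the line of integration. -/
theorem fInv_eq_fInv {c c' ν μ t u : ℝ} (hc : 0 < c) (hc' : 0 < c')
    (hν0 : 0 < ν) (hν1 : ν < 1) (hμ : 0 ≤ μ) (ht : 0 < t) (hu : 0 < u) :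
    fInv c ν μ t u = fInv c' ν μ t u := by
  have hd : ∀ x ∈ Ioi (0 : ℝ), HasDerivAt
      (fun x : ℝ => ∫ y : ℝ, bromwichKernel ν μ t u (x + y * Complex.I)) 0 x := fun x hx =>
    hasDerivAt_integral_bromwichKernel hx hν0 hν1 hμ ht hu
  rw [fInv_eq_integral_bromwichKernel, fInv_eq_integral_bromwichKernel]
  congr 1
  exact isOpen_Ioi.is_const_of_deriv_eq_zero isPreconnected_Ioi
    (fun x hx => (hd x hx).differentiableAt.differentiableWithinAt)
    (fun x hx => (hd x hx).deriv) hc hc'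

/-! ### Absolute convergence of the double Mellin integral -/

theorem integral_gammaKernel_fst {a b c κ ν : ℝ} (ha : 0 < a) (hc : 0 < c) (hκ : 0 < κ) (y : ℝ) :
    ∫ u in Ioi (0 : ℝ), u ^ (a - 1) * Real.exp (-(u * (κ * ‖(c : ℂ) + y * Complex.I‖ ^ ν))) *
      ‖(c : ℂ) + y * Complex.I‖ ^ b =
      Real.Gamma a * κ ^ (-a) * ‖(c : ℂ) + y * Complex.I‖ ^ (b - ν * a) := by
  have hn := norm_vertical_pos hc y
  rw [integral_mul_const, integral_rpow_sub_one_mul_exp_neg_mul ha (by positivity),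
    Real.mul_rpow hκ.le (by positivity), ← Real.rpow_mul hn.le, sub_eq_neg_add, Real.rpow_add hn]
  ring_nf

/-- Tonelli: integrating in `u` leaves a multiple of `‖s‖^(b - νa)`, integrable on the line because
`νa - b > 1`. -/
theorem integrable_prod_gammaKernel {a b c κ ν : ℝ} (ha : 0 < a) (hc : 0 < c) (hκ : 0 < κ)
    (hab : 1 < ν * a - b) :
    Integrable (fun p : ℝ × ℝ => p.1 ^ (a - 1) *
      Real.exp (-(p.1 * (κ * ‖(c : ℂ) + p.2 * Complex.I‖ ^ ν))) *
      ‖(c : ℂ) + p.2 * Complex.I‖ ^ b) ((volume.restrict (Ioi 0)).prod volume) := by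
  rw [integrable_prod_iff' (by fun_prop)]
  refine ⟨Filter.Eventually.of_forall fun y => ?_, ?_⟩
  · have hn := norm_vertical_pos hc y
    have hr : 0 < κ * ‖(c : ℂ) + y * Complex.I‖ ^ ν := by positivity
    exact (integrableOn_rpow_sub_one_mul_exp_neg_mul ha hr).mul_const
      (‖(c : ℂ) + y * Complex.I‖ ^ b)
  · have h := (integrable_norm_vertical_rpow hc hab).const_mul (Real.Gamma a * κ ^ (-a))
    refine h.congr (Filter.Eventually.of_forall fun y => ?_)
    beta_reduce
    rw [neg_sub, ← integral_gammaKernel_fst ha hc hκ]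
    refine setIntegral_congr_fun measurableSet_Ioi fun u (hu : 0 < u) => ?_
    rw [Real.norm_of_nonneg (by positivity)]

theorem integral_prod_gammaKernel {a b c κ ν : ℝ} (ha : 0 < a) (hc : 0 < c) (hκ : 0 < κ)
    (hab : 1 < ν * a - b) :
    ∫ p : ℝ × ℝ, p.1 ^ (a - 1) *
      Real.exp (-(p.1 * (κ * ‖(c : ℂ) + p.2 * Complex.I‖ ^ ν))) *
      ‖(c : ℂ) + p.2 * Complex.I‖ ^ b ∂((volume.restrict (Ioi 0)).prod volume) =
      Real.Gamma a * κ ^ (-a) * ∫ y : ℝ, ‖(c : ℂ) + y * Complex.I‖ ^ (b - ν * a) := by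
  rw [integral_prod_symm _ (integrable_prod_gammaKernel ha hc hκ hab), ← integral_const_mul]
  exact integral_congr_ae (Filter.Eventually.of_forall fun y => integral_gammaKernel_fst ha hc hκ y)

/-- The integrand of the iterated integral for the Mellin transform of `u ↦ f_{ν,μ}(t; u)`. -/
noncomputable def mellinKernel (c ν μ t γ : ℝ) (p : ℝ × ℝ) : ℂ :=
  ((p.1 ^ (γ - 1) : ℝ) : ℂ) * (bromwichKernel ν μ t p.1 (c + p.2 * Complex.I) *
    laplaceLogDeriv ν μ p.1 (c + p.2 * Complex.I))

/-- A bound for the norm of `mellinKernel`. -/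
noncomputable def mellinBound (c ν μ t γ : ℝ) (p : ℝ × ℝ) : ℝ :=
  Real.exp (c * t) * (ν * (p.1 ^ (γ + 1 - 1) *
      Real.exp (-(p.1 * (Real.cos (ν * (Real.pi / 2)) * ‖(c : ℂ) + p.2 * Complex.I‖ ^ ν))) *
      ‖(c : ℂ) + p.2 * Complex.I‖ ^ (ν - 1 - μ)) +
    μ * (p.1 ^ (γ - 1) *
      Real.exp (-(p.1 * (Real.cos (ν * (Real.pi / 2)) * ‖(c : ℂ) + p.2 * Complex.I‖ ^ ν))) *
      ‖(c : ℂ) + p.2 * Complex.I‖ ^ (-1 - μ)))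

theorem norm_mellinKernel_le {c ν μ γ u : ℝ} (t : ℝ) (hc : 0 < c) (hν0 : 0 < ν) (hν1 : ν < 1)
    (hμ : 0 ≤ μ) (hu : 0 < u) (y : ℝ) :
    ‖mellinKernel c ν μ t γ (u, y)‖ ≤ mellinBound c ν μ t γ (u, y) := by
  have hn := norm_vertical_pos hc y
  have h1 := norm_laplaceF_le (μ := μ) hν0 hν1 hu (s := c + y * Complex.I) (by simpa using hc)
  have h2 := norm_laplaceLogDeriv_le hν0 hμ hu ((c : ℂ) + y * Complex.I)
  simp only [mellinKernel, mellinBound, bromwichKernel, norm_mul, Complex.norm_real,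
    norm_cexp_vertical_mul, Real.norm_of_nonneg (Real.rpow_nonneg hu.le (γ - 1))]
  set n : ℝ := ‖(c : ℂ) + y * Complex.I‖ with hn'
  set e : ℝ := Real.exp (-(u * (Real.cos (ν * (Real.pi / 2)) * n ^ ν)))
  calc u ^ (γ - 1) * (Real.exp (c * t) * ‖laplaceF ν μ u (c + y * Complex.I)‖ *
        ‖laplaceLogDeriv ν μ u (c + y * Complex.I)‖)
      ≤ u ^ (γ - 1) * (Real.exp (c * t) * (e * n ^ (-μ)) *
        (u * ν * n ^ (ν - 1) + μ * n⁻¹)) := by gcongr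
    _ = _ := by
      have e1 : u ^ (γ + 1 - 1) = u ^ (γ - 1) * u := by
        rw [← Real.rpow_add_one hu.ne']
        ring_nf
      have e2 : n ^ (ν - 1 - μ) = n ^ (ν - 1) * n ^ (-μ) := by
        rw [← Real.rpow_add hn, sub_eq_add_neg (ν - 1)]
      have e3 : n ^ (-1 - μ) = n⁻¹ * n ^ (-μ) := by
        rw [← Real.rpow_neg_one, ← Real.rpow_add hn, sub_eq_add_neg]
      rw [e1, e2, e3]
      ring

/-- Both summands have `νa - b = 1 + μ + νγ`, which exceeds `1` for every `γ > 0`. -/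
theorem integrable_mellinBound {c ν μ γ : ℝ} (t : ℝ) (hc : 0 < c) (hν0 : 0 < ν) (hν1 : ν < 1)
    (hμ : 0 ≤ μ) (hγ : 0 < γ) :
    Integrable (mellinBound c ν μ t γ) ((volume.restrict (Ioi 0)).prod volume) := by
  have hκ := cos_mul_pi_div_two_pos hν0 hν1
  have hνγ := mul_pos hν0 hγ
  exact (((integrable_prod_gammaKernel (by linarith) hc hκ (by linarith)).const_mul ν).add
    ((integrable_prod_gammaKernel hγ hc hκ (by linarith)).const_mul μ)).const_mul _

/-- `Γ(γ)` is kept as an explicit factor, to cancel the Mittag-Leffler coefficient later; the `γ` in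
`ν γ / κ` comes from `Γ(γ+1) = γ Γ(γ)`. -/
theorem integral_mellinBound {c ν μ γ : ℝ} (t : ℝ) (hc : 0 < c) (hν0 : 0 < ν) (hν1 : ν < 1)
    (hμ : 0 ≤ μ) (hγ : 0 < γ) :
    ∫ p, mellinBound c ν μ t γ p ∂((volume.restrict (Ioi 0)).prod volume) =
      Real.Gamma γ * (Real.exp (c * t) * (ν * γ / Real.cos (ν * (Real.pi / 2)) + μ) *
        Real.cos (ν * (Real.pi / 2)) ^ (-γ) *
        ∫ y : ℝ, ‖(c : ℂ) + y * Complex.I‖ ^ (-(1 + μ + ν * γ))) := by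
  have hκ := cos_mul_pi_div_two_pos hν0 hν1
  have hνγ := mul_pos hν0 hγ
  have hi1 := integrable_prod_gammaKernel (a := γ + 1) (b := ν - 1 - μ) (ν := ν) (by linarith)
    hc hκ (by linarith)
  have hi2 := integrable_prod_gammaKernel (a := γ) (b := -1 - μ) (ν := ν) hγ hc hκ (by linarith)
  unfold mellinBound
  rw [integral_const_mul, integral_add (hi1.const_mul ν) (hi2.const_mul μ), integral_const_mul,
    integral_const_mul, integral_prod_gammaKernel (by linarith) hc hκ (by linarith),
    integral_prod_gammaKernel hγ hc hκ (by linarith), Real.Gamma_add_one hγ.ne',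
    show ν - 1 - μ - ν * (γ + 1) = -(1 + μ + ν * γ) by ring,
    show -1 - μ - ν * γ = -(1 + μ + ν * γ) by ring, neg_add, Real.rpow_add hκ, Real.rpow_neg_one]
  generalize (∫ y : ℝ, ‖(c : ℂ) + y * Complex.I‖ ^ (-(1 + μ + ν * γ))) = J
  ring

theorem measurable_mellinKernel {c : ℝ} (ν μ t γ : ℝ) :
    Measurable (mellinKernel c ν μ t γ) := by
  unfold mellinKernel bromwichKernel laplaceLogDeriv laplaceF
  fun_prop

theorem integrable_mellinKernel {c ν μ γ : ℝ} (t : ℝ) (hc : 0 < c) (hν0 : 0 < ν) (hν1 : ν < 1)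
    (hμ : 0 ≤ μ) (hγ : 0 < γ) :
    Integrable (mellinKernel c ν μ t γ) ((volume.restrict (Ioi 0)).prod volume) := by
  refine (integrable_mellinBound t hc hν0 hν1 hμ hγ).mono'
    (measurable_mellinKernel ν μ t γ).aestronglyMeasurable ?_
  have h : ∀ᵐ p : ℝ × ℝ ∂((volume.restrict (Ioi 0)).prod volume), p.1 ∈ Ioi (0 : ℝ) :=
    Measure.quasiMeasurePreserving_fst.ae (ae_restrict_mem measurableSet_Ioi)
  filter_upwards [h] with p hp
  exact norm_mellinKernel_le t hc hν0 hν1 hμ hp p.2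

theorem rpow_mul_fInv_eq {c ν μ t u : ℝ} (γ : ℝ) (hc : 0 < c)
    (hν0 : 0 < ν) (hν1 : ν < 1) (hμ : 0 ≤ μ) (ht : 0 < t) (hu : 0 < u) :
    ((u ^ (γ - 1) : ℝ) : ℂ) * fInv c ν μ t u =
      1 / (2 * Real.pi * t) * ∫ y : ℝ, mellinKernel c ν μ t γ (u, y) := by
  rw [fInv_eq_integral_mul_laplaceLogDeriv hc hν0 hν1 hμ ht hu]
  simp only [mellinKernel]
  rw [integral_const_mul]
  ring

theorem integrableOn_rpow_mul_fInv {c ν μ t γ : ℝ} (hc : 0 < c)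
    (hν0 : 0 < ν) (hν1 : ν < 1) (hμ : 0 ≤ μ) (ht : 0 < t) (hγ : 0 < γ) :
    IntegrableOn (fun u : ℝ => ((u ^ (γ - 1) : ℝ) : ℂ) * fInv c ν μ t u) (Ioi 0) := by
  have h := (integrable_mellinKernel t hc hν0 hν1 hμ hγ).integral_prod_left.const_mul
    (1 / (2 * Real.pi * t) : ℂ)
  refine IntegrableOn.congr_fun h (fun u hu => ?_) measurableSet_Ioi
  exact (rpow_mul_fInv_eq γ hc hν0 hν1 hμ ht hu).symm

theorem integral_norm_rpow_mul_fInv_le {c ν μ t γ : ℝ} (hc : 0 < c)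
    (hν0 : 0 < ν) (hν1 : ν < 1) (hμ : 0 ≤ μ) (ht : 0 < t) (hγ : 0 < γ) :
    ∫ u in Ioi (0 : ℝ), ‖((u ^ (γ - 1) : ℝ) : ℂ) * fInv c ν μ t u‖ ≤ 1 / (2 * Real.pi * t) *
      (Real.Gamma γ * (Real.exp (c * t) * (ν * γ / Real.cos (ν * (Real.pi / 2)) + μ) *
        Real.cos (ν * (Real.pi / 2)) ^ (-γ) *
        ∫ y : ℝ, ‖(c : ℂ) + y * Complex.I‖ ^ (-(1 + μ + ν * γ)))) := by
  have hb := integrable_mellinBound t hc hν0 hν1 hμ hγ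
  rw [← integral_mellinBound t hc hν0 hν1 hμ hγ, integral_prod _ hb, ← integral_const_mul]
  refine integral_mono_ae (integrableOn_rpow_mul_fInv hc hν0 hν1 hμ ht hγ).norm
    (hb.integral_prod_left.const_mul _) ?_
  filter_upwards [ae_restrict_mem measurableSet_Ioi, hb.prod_right_ae] with u (hu : 0 < u) hbu
  rw [rpow_mul_fInv_eq γ hc hν0 hν1 hμ ht hu, norm_mul]
  have hn : ‖(1 / (2 * Real.pi * t) : ℂ)‖ = 1 / (2 * Real.pi * t) := by
    simp [abs_of_pos Real.pi_pos, abs_of_pos ht]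
  rw [hn]
  gcongr
  exact norm_integral_le_of_norm_le hbu
    (Filter.Eventually.of_forall fun y => norm_mellinKernel_le t hc hν0 hν1 hμ hu y)

/-! ### Evaluation of the Mellin transform -/

/-- `ν arg s` stays inside `(-π, π)`, so no branch is crossed. -/
theorem cpow_cpow_of_re_pos {ν : ℝ} (hν0 : 0 < ν) (hν1 : ν < 1) {s : ℂ} (hs : 0 < s.re) (a : ℂ) :
    (s ^ (ν : ℂ)) ^ a = s ^ (ν * a) := by
  have harg : |s.arg| ≤ Real.pi / 2 := Complex.abs_arg_le_pi_div_two_iff.2 hs.le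
  have h := abs_le.1 harg
  have him : (Complex.log s * ν).im = s.arg * ν := by simp [Complex.log_im]
  rw [Complex.cpow_mul]
  · rw [him]
    nlinarith [Real.pi_pos]
  · rw [him]
    nlinarith [Real.pi_pos]

/-- Both summands produce the same power of `s`. The factor `νγ + μ` cancels later against
`Γ(μ+νγ+1) = (μ+νγ) Γ(μ+νγ)`. -/
theorem integral_mellinKernel_fst {c ν μ γ : ℝ} (t : ℝ) (hc : 0 < c)
    (hν0 : 0 < ν) (hν1 : ν < 1) (hγ : 0 < γ) (y : ℝ) :
    ∫ u in Ioi (0 : ℝ), mellinKernel c ν μ t γ (u, y) =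
      (Real.Gamma γ * (ν * γ + μ)) * (Complex.exp ((c + y * Complex.I) * t) *
        ((c : ℂ) + y * Complex.I) ^ (-(μ + ν * γ + 1 : ℝ) : ℂ)) := by
  have hs : 0 < ((c : ℂ) + y * Complex.I).re := by simpa using hc
  have hs0 := vertical_ne_zero hc y
  set s : ℂ := c + y * Complex.I
  have hre := re_cpow_pos hν0 hν1 hs
  have hi1 := integrableOn_rpow_sub_one_mul_cexp_neg_mul (a := γ + 1) (by linarith) hre
  have hi2 := integrableOn_rpow_sub_one_mul_cexp_neg_mul hγ hre
  have hsplit : ∀ u ∈ Ioi (0 : ℝ), mellinKernel c ν μ t γ (u, y) =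
      Complex.exp (s * t) / s ^ (μ : ℂ) * ν * s ^ ((ν - 1 : ℝ) : ℂ) *
        (((u ^ (γ + 1 - 1) : ℝ) : ℂ) * Complex.exp (-(u * s ^ (ν : ℂ)))) +
      Complex.exp (s * t) / s ^ (μ : ℂ) * μ * s⁻¹ *
        (((u ^ (γ - 1) : ℝ) : ℂ) * Complex.exp (-(u * s ^ (ν : ℂ)))) := by
    intro u (hu : 0 < u)
    have e1 : u ^ (γ + 1 - 1) = u ^ (γ - 1) * u := by
      rw [← Real.rpow_add_one hu.ne']
      ring_nf
    rw [e1]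
    simp only [mellinKernel, bromwichKernel, laplaceF, laplaceLogDeriv]
    push_cast
    ring
  rw [setIntegral_congr_fun measurableSet_Ioi hsplit,
    integral_add (hi1.const_mul _) (hi2.const_mul _), integral_const_mul, integral_const_mul,
    integral_rpow_sub_one_mul_cexp_neg_mul (by linarith) hre,
    integral_rpow_sub_one_mul_cexp_neg_mul hγ hre, cpow_cpow_of_re_pos hν0 hν1 hs,
    cpow_cpow_of_re_pos hν0 hν1 hs, Real.Gamma_add_one hγ.ne', div_eq_mul_inv, ← Complex.cpow_neg,
    ← Complex.cpow_neg_one s]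
  have e2 : s ^ (-(μ : ℂ)) * s ^ ((ν - 1 : ℝ) : ℂ) * s ^ ((ν : ℂ) * -((γ + 1 : ℝ) : ℂ)) =
      s ^ (-(μ + ν * γ + 1 : ℝ) : ℂ) := by
    rw [← Complex.cpow_add _ _ hs0, ← Complex.cpow_add _ _ hs0]
    congr 1
    push_cast
    ring
  have e3 : s ^ (-(μ : ℂ)) * s ^ (-1 : ℂ) * s ^ ((ν : ℂ) * -(γ : ℂ)) =
      s ^ (-(μ + ν * γ + 1 : ℝ) : ℂ) := by
    rw [← Complex.cpow_add _ _ hs0, ← Complex.cpow_add _ _ hs0]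
    congr 1
    push_cast
    ring
  calc _ = Complex.exp (s * t) * ν * (((γ * Real.Gamma γ : ℝ) : ℂ)) * (s ^ (-(μ : ℂ)) *
        s ^ ((ν - 1 : ℝ) : ℂ) * s ^ ((ν : ℂ) * -((γ + 1 : ℝ) : ℂ))) +
        Complex.exp (s * t) * μ * Real.Gamma γ *
        (s ^ (-(μ : ℂ)) * s ^ (-1 : ℂ) * s ^ ((ν : ℂ) * -(γ : ℂ))) := by ring
    _ = _ := by
      rw [e2, e3]
      push_cast
      ring

/-- The Mellin transform of `u ↦ f_{ν,μ}(t; u)`. -/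
theorem integral_rpow_mul_fInv {c ν μ t γ : ℝ} (hc : 0 < c)
    (hν0 : 0 < ν) (hν1 : ν < 1) (hμ : 0 ≤ μ) (ht : 0 < t) (hγ : 0 < γ) :
    ∫ u in Ioi (0 : ℝ), ((u ^ (γ - 1) : ℝ) : ℂ) * fInv c ν μ t u =
      Real.Gamma γ * ((t ^ (γ * ν + μ - 1) : ℝ) : ℂ) / Real.Gamma (γ * ν + μ) := by
  have hδ : 0 < μ + ν * γ := by
    have := mul_pos hν0 hγ
    linarith
  have hΓ : Real.Gamma (μ + ν * γ) ≠ 0 := (Real.Gamma_pos_of_pos hδ).ne'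
  rw [setIntegral_congr_fun measurableSet_Ioi
      (fun u hu => rpow_mul_fInv_eq γ hc hν0 hν1 hμ ht hu), integral_const_mul,
    integral_integral_swap (f := fun u y => mellinKernel c ν μ t γ (u, y))
      (integrable_mellinKernel t hc hν0 hν1 hμ hγ)]
  simp_rw [integral_mellinKernel_fst t hc hν0 hν1 hγ]
  rw [integral_const_mul, integral_cexp_mul_vertical_cpow hc hδ ht, Real.Gamma_add_one hδ.ne',
    show γ * ν + μ = μ + ν * γ by ring, Real.rpow_sub_one ht.ne']
  have h1 : (Real.Gamma (μ + ν * γ) : ℂ) ≠ 0 := Complex.ofReal_ne_zero.2 hΓ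
  have h2 : (ν * γ + μ : ℂ) ≠ 0 := by
    rw [add_comm]
    exact_mod_cast hδ.ne'
  have h3 : (t : ℂ) ≠ 0 := Complex.ofReal_ne_zero.2 ht.ne'
  have h4 : (Real.pi : ℂ) ≠ 0 := Complex.ofReal_ne_zero.2 Real.pi_ne_zero
  push_cast
  rw [add_comm (μ : ℂ)]
  field_simp

/-! ### Termwise integration of the Mittag-Leffler series -/

/-- The terms of the series obtained by expanding `E_{α,β}` in the integral transform. -/
noncomputable def mittagLefflerTerm (α β c ν μ t : ℝ) (w : ℂ) (k : ℕ) (u : ℝ) : ℂ :=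
  w ^ k / Real.Gamma (k * α + β) * (((u ^ (k * α + β - 1) : ℝ) : ℂ) * fInv c ν μ t u)

theorem tsum_mittagLefflerTerm {α β u : ℝ} (c ν μ t : ℝ) (w : ℂ) (hu : 0 < u) :
    ∑' k, mittagLefflerTerm α β c ν μ t w k u =
      ((u ^ (β - 1) : ℝ) : ℂ) * mittagLeffler α β (w * ((u ^ α : ℝ) : ℂ)) * fInv c ν μ t u := by
  rw [mittagLeffler, ← tsum_mul_left, ← tsum_mul_right]
  refine tsum_congr fun k => ?_
  have h : u ^ (k * α + β - 1) = (u ^ α) ^ k * u ^ (β - 1) := by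
    rw [← Real.rpow_natCast, ← Real.rpow_mul hu.le, ← Real.rpow_add hu]
    ring_nf
  rw [mittagLefflerTerm, h, Complex.Gamma_ofReal, mul_pow]
  push_cast
  ring

theorem exists_norm_mul_rpow_lt_one {κ ν α : ℝ} (hν0 : 0 < ν) (hα : 0 < α) (w : ℂ) :
    ∃ c : ℝ, 0 < c ∧ ‖w‖ * κ ^ (-α) * c ^ (-(ν * α)) < 1 := by
  have h := (tendsto_rpow_neg_atTop (mul_pos hν0 hα)).const_mul (‖w‖ * κ ^ (-α))
  rw [mul_zero] at h
  obtain ⟨c, h1, h2⟩ :=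
    ((Filter.eventually_gt_atTop (0 : ℝ)).and (h.eventually_lt_const one_pos)).exists
  exact ⟨c, h1, h2⟩

/-- Extracting `c^(-b)` through `c ≤ ‖s‖` provides the geometric decay in `k`, while the remaining
integral does not depend on `k`. -/
theorem integral_norm_vertical_rpow_le {c a b : ℝ} (hc : 0 < c) (ha : 1 < a) (hb : 0 ≤ b) :
    ∫ y : ℝ, ‖(c : ℂ) + y * Complex.I‖ ^ (-(a + b)) ≤
      c ^ (-b) * ∫ y : ℝ, ‖(c : ℂ) + y * Complex.I‖ ^ (-a) := by
  rw [← integral_const_mul]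
  refine integral_mono (integrable_norm_vertical_rpow hc (by linarith))
    ((integrable_norm_vertical_rpow hc ha).const_mul _) fun y => ?_
  beta_reduce
  rw [neg_add, Real.rpow_add (norm_vertical_pos hc y), mul_comm]
  gcongr ?_ * _
  exact Real.rpow_le_rpow_of_nonpos hc (le_norm_vertical c y) (by linarith)

theorem summable_integral_norm_mittagLefflerTerm {α β c ν μ t : ℝ} {w : ℂ} (hα : 0 < α)
    (hβ : 0 < β) (hc : 0 < c) (hν0 : 0 < ν) (hν1 : ν < 1) (hμ : 0 ≤ μ) (ht : 0 < t)
    (hw : ‖w‖ * Real.cos (ν * (Real.pi / 2)) ^ (-α) * c ^ (-(ν * α)) < 1) :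
    Summable fun k : ℕ => ∫ u in Ioi (0 : ℝ), ‖mittagLefflerTerm α β c ν μ t w k u‖ := by
  have hκ := cos_mul_pi_div_two_pos hν0 hν1
  set κ := Real.cos (ν * (Real.pi / 2))
  set q := ‖w‖ * κ ^ (-α) * c ^ (-(ν * α)) with hq
  have hq0 : 0 ≤ q := by positivity
  have hqn : ‖q‖ < 1 := by rwa [Real.norm_of_nonneg hq0]
  set J := ∫ y : ℝ, ‖(c : ℂ) + y * Complex.I‖ ^ (-(1 + μ + ν * β)) with hJ
  have hJ0 : 0 ≤ J := integral_nonneg fun y => by positivity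
  -- The bound is linear in `k` times `q^k`; the exponent in `(k : ℝ) ^ 1` fits the lemma on `k^m
  -- r^k`.
  have hsum : Summable fun k : ℕ => 1 / (2 * Real.pi * t) * Real.exp (c * t) * κ ^ (-β) * J *
      (ν * α / κ * ((k : ℝ) ^ 1 * q ^ k) + (ν * β / κ + μ) * q ^ k) :=
    (((summable_pow_mul_geometric_of_norm_lt_one 1 hqn).mul_left _).add
      ((summable_geometric_of_norm_lt_one hqn).mul_left _)).mul_left _
  refine hsum.of_nonneg_of_le (fun k => integral_nonneg fun u => norm_nonneg _) fun k => ?_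
  have hγ : 0 < k * α + β := by positivity
  have hΓ := Real.Gamma_pos_of_pos hγ
  simp_rw [mittagLefflerTerm, norm_mul (w ^ k / _)]
  rw [integral_const_mul, norm_div, norm_pow, Complex.norm_real, Real.norm_of_nonneg hΓ.le]
  have h1 := integral_norm_rpow_mul_fInv_le hc hν0 hν1 hμ ht hγ
  have h2 := integral_norm_vertical_rpow_le (a := 1 + μ + ν * β) (b := ν * α * k) hc
    (by have := mul_pos hν0 hβ; linarith) (by positivity)
  rw [show 1 + μ + ν * β + ν * α * k = 1 + μ + ν * (k * α + β) by ring] at h2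
  calc _ ≤ ‖w‖ ^ k / Real.Gamma (k * α + β) * (1 / (2 * Real.pi * t) *
        (Real.Gamma (k * α + β) * (Real.exp (c * t) * (ν * (k * α + β) / κ + μ) *
        κ ^ (-(k * α + β)) * (c ^ (-(ν * α * k)) * J)))) := by
        refine mul_le_mul_of_nonneg_left (h1.trans ?_) (by positivity)
        gcongr
    _ = _ := by
      have e1 : κ ^ (-(k * α + β)) = (κ ^ (-α)) ^ k * κ ^ (-β) := by
        rw [← Real.rpow_natCast, ← Real.rpow_mul hκ.le, ← Real.rpow_add hκ]
        ring_nf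
      have e2 : c ^ (-(ν * α * k)) = (c ^ (-(ν * α))) ^ k := by
        rw [← Real.rpow_natCast, ← Real.rpow_mul hc.le]
        ring_nf
      rw [e1, e2, hq, mul_pow, mul_pow]
      field_simp
      ring

theorem integrableOn_mittagLefflerTerm {α β c ν μ t : ℝ} (w : ℂ) (hα : 0 < α)
    (hβ : 0 < β) (hc : 0 < c) (hν0 : 0 < ν) (hν1 : ν < 1) (hμ : 0 ≤ μ) (ht : 0 < t) (k : ℕ) :
    IntegrableOn (mittagLefflerTerm α β c ν μ t w k) (Ioi 0) :=
  (integrableOn_rpow_mul_fInv hc hν0 hν1 hμ ht (by positivity)).const_mul _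

theorem integral_mittagLefflerTerm {α β c ν μ t : ℝ} (w : ℂ) (hα : 0 < α)
    (hβ : 0 < β) (hc : 0 < c) (hν0 : 0 < ν) (hν1 : ν < 1) (hμ : 0 ≤ μ) (ht : 0 < t) (k : ℕ) :
    ∫ u in Ioi (0 : ℝ), mittagLefflerTerm α β c ν μ t w k u =
      ((t ^ (β * ν + μ - 1) : ℝ) : ℂ) * ((w * ((t ^ (α * ν) : ℝ) : ℂ)) ^ k /
        Complex.Gamma ((k * (α * ν) + (β * ν + μ) : ℝ) : ℂ)) := by
  have hγ : 0 < k * α + β := by positivity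
  have hΓ : (Real.Gamma (k * α + β) : ℂ) ≠ 0 :=
    Complex.ofReal_ne_zero.2 (Real.Gamma_pos_of_pos hγ).ne'
  have h : t ^ ((k * α + β) * ν + μ - 1) = (t ^ (α * ν)) ^ k * t ^ (β * ν + μ - 1) := by
    rw [← Real.rpow_natCast, ← Real.rpow_mul ht.le, ← Real.rpow_add ht]
    ring_nf
  unfold mittagLefflerTerm
  rw [integral_const_mul, integral_rpow_mul_fInv hc hν0 hν1 hμ ht hγ, h, Complex.Gamma_ofReal,
    show (k * α + β) * ν + μ = k * (α * ν) + (β * ν + μ) by ring, mul_pow]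
  push_cast
  field_simp

theorem integral_mittagLeffler_mul_fInv {α β c ν μ t : ℝ} (w : ℂ) (hα : 0 < α)
    (hβ : 0 < β) (hc : 0 < c) (hν0 : 0 < ν) (hν1 : ν < 1) (hμ : 0 ≤ μ) (ht : 0 < t) :
    IntegrableOn (fun u : ℝ => ((u ^ (β - 1) : ℝ) : ℂ) *
        mittagLeffler α β (w * ((u ^ α : ℝ) : ℂ)) * fInv c ν μ t u) (Ioi 0) ∧
      ∫ u in Ioi (0 : ℝ), ((u ^ (β - 1) : ℝ) : ℂ) *
          mittagLeffler α β (w * ((u ^ α : ℝ) : ℂ)) * fInv c ν μ t u =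
        ((t ^ (β * ν + μ - 1) : ℝ) : ℂ) *
          mittagLeffler (α * ν) (β * ν + μ) (w * ((t ^ (α * ν) : ℝ) : ℂ)) := by
  -- The abscissa `c'` depends on `w` and makes the ratio `q` less than `1`; moving the line there
  -- does not change `f`.
  obtain ⟨c', hc', hw⟩ := exists_norm_mul_rpow_lt_one (κ := Real.cos (ν * (Real.pi / 2))) hν0 hα w
  have heq : EqOn (fun u : ℝ => ∑' k, mittagLefflerTerm α β c' ν μ t w k u)
      (fun u : ℝ => ((u ^ (β - 1) : ℝ) : ℂ) *
        mittagLeffler α β (w * ((u ^ α : ℝ) : ℂ)) * fInv c ν μ t u) (Ioi 0) := fun u hu => by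
    beta_reduce
    rw [fInv_eq_fInv hc hc' hν0 hν1 hμ ht hu, tsum_mittagLefflerTerm c' ν μ t w hu]
  have hint := integrableOn_mittagLefflerTerm w hα hβ hc' hν0 hν1 hμ ht
  have hs := summable_integral_norm_mittagLefflerTerm hα hβ hc' hν0 hν1 hμ ht hw
  refine ⟨IntegrableOn.congr_fun (integrable_tsum_of_summable_integral_norm hint hs) heq
    measurableSet_Ioi, ?_⟩
  rw [← setIntegral_congr_fun measurableSet_Ioi heq,
    ← integral_tsum_of_summable_integral_norm hint hs, mittagLeffler, ← tsum_mul_left]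
  exact tsum_congr fun k => integral_mittagLefflerTerm w hα hβ hc' hν0 hν1 hμ ht k

theorem mainTheorem4 (α ν μ t c : ℝ) (lam : ℂ)
    (hα : 0 < α) (hν0 : 0 < ν) (hν1 : ν < 1) (hμ : 0 ≤ μ) (ht : 0 < t) (hc : 0 < c)
    (ε : ℂ) (hε : ε = 1 ∨ ε = -1) :
    (∀ β : ℝ, 0 < β →
      IntegrableOn (fun u : ℝ => ((u ^ (β - 1) : ℝ) : ℂ) *
        mittagLeffler α β (ε * lam * ((u ^ α : ℝ) : ℂ)) * fInv c ν μ t u) (Ioi 0) ∧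
      ∫ u in Ioi (0 : ℝ), ((u ^ (β - 1) : ℝ) : ℂ) *
          mittagLeffler α β (ε * lam * ((u ^ α : ℝ) : ℂ)) * fInv c ν μ t u =
        ((t ^ (β * ν + μ - 1) : ℝ) : ℂ) *
          mittagLeffler (α * ν) (β * ν + μ) (ε * lam * ((t ^ (α * ν) : ℝ) : ℂ))) ∧
    (∫ u in Ioi (0 : ℝ), mittagLeffler α 1 (ε * lam * ((u ^ α : ℝ) : ℂ)) * fInv c ν μ t u =
        ((t ^ (ν + μ - 1) : ℝ) : ℂ) *
          mittagLeffler (α * ν) (ν + μ) (ε * lam * ((t ^ (α * ν) : ℝ) : ℂ))) ∧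
    (∫ u in Ioi (0 : ℝ), ((u ^ (α - 1) : ℝ) : ℂ) *
          mittagLeffler α α (ε * lam * ((u ^ α : ℝ) : ℂ)) * fInv c ν μ t u =
        ((t ^ (α * ν + μ - 1) : ℝ) : ℂ) *
          mittagLeffler (α * ν) (α * ν + μ) (ε * lam * ((t ^ (α * ν) : ℝ) : ℂ))) ∧
    (∫ u in Ioi (0 : ℝ), ((u ^ α : ℝ) : ℂ) *
          mittagLeffler α (α + 1) (ε * lam * ((u ^ α : ℝ) : ℂ)) * fInv c ν μ t u =
        ((t ^ ((α + 1) * ν + μ - 1) : ℝ) : ℂ) *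
          mittagLeffler (α * ν) ((α + 1) * ν + μ) (ε * lam * ((t ^ (α * ν) : ℝ) : ℂ))) := by

  have key := fun (β : ℝ) (hβ : 0 < β) =>
    integral_mittagLeffler_mul_fInv (c := c) (ε * lam) hα hβ hc hν0 hν1 hμ ht
  refine ⟨key, ?_, (key α hα).2, ?_⟩
  · simpa using (key 1 one_pos).2
  · simpa using (key (α + 1) (by linarith)).2
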